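/- For $s\in(1,2]$ let $T(x)=\min\{sx,s(1-x)\}$ be the tent map on $[0,1]$, with critical point $c=\tfrac12$, and put $c_k=T^k(c)$. Assume that the orbit of $c$ is infinite. Let $$X=\varprojlim([0,1],T)=\{(\dots,x_{-2},x_{-1},x_0)\in[0,1]^{\mathbb N_0}: T(x_{-i-1})=x_{-i}\text{ for all } i\ge 0\}$$ with the product topology, and let $X'=\varprojlim([c_2,c_1],T)\subset X$ be the core inverse limit space. Let $D_1=[c,c_1]$ and, for $n\ge1$, let $D_{n+1}$ be the closed interval with endpoints $c_{n+1}$ and $c_1$ if $c\in D_n$, and $D_{n+1}=T(D_n)$ if $c\notin D_n$. Assume that $T$ is long-branched, i.e. $\inf_n|D_n|>0$. A continuum is a non-empty compact connected metric space, and an arc is a space homeomorphic to $[0,1]$. Let $\mathcal E$ be the set of endpoints of $X$, i.e. of those $x\in X$ such that any two subcontinua $A,B\subset X$ containing $x$ satisfy $A\subset B$ or $B\subset A$. A sequence $\overleftarrow{e}=\dots e_{-2}e_{-1}\in\{0,1\}^{\mathbb N}$ is a left itinerary of $x$ if, for every $i\ge1$, $e_{-i}=0$ when $x_{-i}<c$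 and $e_{-i}=1$ when $x_{-i}>c$ (both symbols are allowed when $x_{-i}=c$); the basic arc $A(\overleftarrow{e})$ is the closure of the set of points of $X$ with left itinerary $\overleftarrow{e}$. Let $\mathcal E_F\subset\mathcal E$ be the set of flat endpoints, i.e. of those $x\in\mathcal E$ that have a left itinerary $\overleftarrow{e}$ such that $A(\overleftarrow{e})$ is a (non-degenerate) arc with $x$ as one of its two endpoints. Then: 1. if $s>\sqrt2$, then every proper subcontinuum of $X'$ that is not a single point is an arc; 2. $\mathcal E\cap X'\ne\emptyset$ if and only if $c$ is recurrent (that is, $c\in\omega(c)$); 3. if $c$ is recurrent, then all endpoints are flat, i.e. $\mathcal E=\mathcal E_F$. -/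

import Mathlib

open Set Filter Topology

noncomputable section

namespace TentInvLim

/-- The tent map `T_s(x) = min {s x, s (1 - x)}`, with critical point `c = 1/2`. -/
def tent (s x : ℝ) : ℝ := min (s * x) (s * (1 - x))

/-- The point `c_k = T^k(c)` of the critical orbit. -/
def crit (s : ℝ) (k : ℕ) : ℝ := (tent s)^[k] (1 / 2)

/-- The inverse limit of `T_s` over a set `J`, as a subset of the countable product `ℕ → ℝ`
with the product topology. The coordinate `x i` is the projection `π_i(x) = x_{-i}`. -/
def invLim (s : ℝ) (J : Set ℝ) : Set (ℕ → ℝ) :=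
  {x | (∀ i, x i ∈ J) ∧ ∀ i, tent s (x (i + 1)) = x i}

/-- `X`, the inverse limit of `T_s` on `[0, 1]`. -/
def space (s : ℝ) : Set (ℕ → ℝ) := invLim s (Icc 0 1)

/-- `X'`, the inverse limit of `T_s` on the core `[c_2, c_1]`. -/
def coreSpace (s : ℝ) : Set (ℕ → ℝ) := invLim s (Icc (crit s 2) (crit s 1))

open Classical in
/-- The levels of the Hofbauer tower: `D s n` is the interval `D_{n+1}`, where `D_1 = [c, c_1]`,
and `D_{n+1}` is `[c_{n+1}, c_1]` if `c ∈ D_n` and `T(D_n)` otherwise. -/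
def D (s : ℝ) : ℕ → Set ℝ
  | 0 => uIcc (1 / 2) (crit s 1)
  | n + 1 => if (1 / 2 : ℝ) ∈ D s n then uIcc (crit s (n + 2)) (crit s 1) else tent s '' D s n

/-- `T_s` is long-branched: `inf_n |D_n| > 0`. -/
def LongBranched (s : ℝ) : Prop := ∃ δ > 0, ∀ n, δ ≤ Metric.diam (D s n)

/-- The critical point is recurrent: `c ∈ ω(c)`. -/
def CritRecurrent (s : ℝ) : Prop := MapClusterPt (1 / 2) atTop (crit s)

/-- `H` is a subcontinuum of `K`: a nonempty compact connected subset. -/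
def IsSubcontinuum {E : Type*} [TopologicalSpace E] (H K : Set E) : Prop :=
  H ⊆ K ∧ IsCompact H ∧ IsConnected H

/-- `A` is a (non-degenerate) arc. -/
def IsArc {E : Type*} [TopologicalSpace E] (A : Set E) : Prop :=
  Nonempty (unitInterval ≃ₜ A)

/-- `A` is a (non-degenerate) arc and `x` is one of its two endpoints. -/
def IsArcEnd {E : Type*} [TopologicalSpace E] (A : Set E) (x : E) : Prop :=
  ∃ h : unitInterval ≃ₜ A, (h 0 : E) = x

/-- The endpoints of a (chainable) continuum `K`: the points `x` such that any two subcontinua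
of `K` that contain `x` are nested. -/
def endpoints {E : Type*} [TopologicalSpace E] (K : Set E) : Set E :=
  {x | x ∈ K ∧ ∀ A B : Set E, IsSubcontinuum A K → IsSubcontinuum B K → x ∈ A → x ∈ B →
    A ⊆ B ∨ B ⊆ A}

/-- The sequence `… e 1, e 0`, where `e i` is the symbol `s_{-(i+1)}` (`false` for `0` and `true`
for `1`), is a left itinerary of `x`. Both symbols are allowed where `x_{-(i+1)} = c`. -/
def IsLeftItinerary (x : ℕ → ℝ) (e : ℕ → Bool) : Prop :=
  ∀ i, (x (i + 1) < 1 / 2 → e i = false) ∧ (1 / 2 < x (i + 1) → e i = true)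

/-- The basic arc `A(e)`: the closure of the set of points of `X` with left itinerary `e`. -/
def basicArc (s : ℝ) (e : ℕ → Bool) : Set (ℕ → ℝ) :=
  closure {x | x ∈ space s ∧ IsLeftItinerary x e}

/-- The set of flat endpoints of `X`: the endpoints of `X` that are endpoints of
their own basic arc, this basic arc being non-degenerate. -/
def flatEndpoints (s : ℝ) : Set (ℕ → ℝ) :=
  {x | x ∈ endpoints (space s) ∧
    ∃ e : ℕ → Bool, IsLeftItinerary x e ∧ IsArcEnd (basicArc s e) x}

end TentInvLim

end

/-!
Coordinates of the inverse limit expand: a difference in the coordinate `n` reappears in the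
coordinate `n + k` divided by at most `s ^ k`. If `c` is recurrent, backward orbits of ever closer
returns of `c` converge to a point `x` some of whose coordinates `x m` are so close to the maximum
`c_1` of `T` that there is no room above them for two subcontinua to separate, so `x` is an
endpoint. Conversely, if `x` is an endpoint of `X` in the core, then the inverse branches of `T`
along the itinerary of `x` cannot all be defined on one interval around `x 0`; the first obstruction
is a point of the critical orbit near `x 0` that is pulled back to `c` near a coordinate of `x`.
Applying this twice brings the critical orbit back to `c`.

Long-branchedness enters through the Hofbauer tower. Images of cylinders have an end `c_{a+1}`, and
projections of subcontinua contain such a point, for which the part of the interval on its side of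
`c` lies in `D_{a+1}`. If the interval contains `c`, then so does `D_{a+1}`, and
`δ ≤ |D_{a+2}| = s |c_{a+1} - c|` bounds the length of the interval from below.
* The projections of a proper subcontinuum of the core shrink when `s > √2`, because eventually
  no two consecutive ones contain `c`. Hence they eventually avoid `c` altogether, and the
  coordinates there are injective.
* The images of the cylinders along an itinerary all have length at least `δ`, hence so does their
  intersection, which parametrizes the basic arc. A point of `X` which is not an end of its basic
  arc is not an endpoint of `X`.
-/

namespace TentInvLim

variable {s : ℝ} {b : Bool}

/-! ### The tent map and its laps -/

/-- The closed half-line coded by the symbol `b`, on which `T` is affine. -/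
def lap : Bool → Set ℝ
  | false => Iic (1 / 2)
  | true => Ici (1 / 2)

theorem isClosed_lap (b : Bool) : IsClosed (lap b) := by
  cases b
  exacts [isClosed_Iic, isClosed_Ici]

theorem ordConnected_lap (b : Bool) : OrdConnected (lap b) := by
  cases b
  exacts [ordConnected_Iic, ordConnected_Ici]

theorem ordConnected_compl_lap (b : Bool) : OrdConnected (lap b)ᶜ := by
  cases b
  · exact compl_Iic (a := (1 / 2 : ℝ)) ▸ ordConnected_Ioi
  · exact compl_Ici (a := (1 / 2 : ℝ)) ▸ ordConnected_Iio

theorem half_mem_lap (b : Bool) : (1 / 2 : ℝ) ∈ lap b := by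
  cases b
  exacts [self_mem_Iic, self_mem_Ici]

theorem exists_mem_lap (x : ℝ) : ∃ b, x ∈ lap b :=
  (le_total x (1 / 2)).elim (fun h => ⟨false, h⟩) fun h => ⟨true, h⟩

theorem subset_lap_of_half_notMem {J : Set ℝ} (hJ : OrdConnected J) (hhalf : (1 / 2 : ℝ) ∉ J)
    {x : ℝ} (hxJ : x ∈ J) (hx : x ∈ lap b) : J ⊆ lap b := by
  intro y hy
  by_contra hyb
  refine hhalf ?_
  cases b
  · exact hJ.out hxJ hy ⟨hx, (not_le.1 hyb).le⟩
  · exact hJ.out hy hxJ ⟨(not_le.1 hyb).le, hx⟩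

theorem uIcc_inter_lap {p q : ℝ} (hp : p ∈ lap b) (hp_ne : p ≠ 1 / 2)
    (hhalf : (1 / 2 : ℝ) ∈ uIcc p q) : uIcc p q ∩ lap b = uIcc p (1 / 2) := by
  refine Subset.antisymm (fun y ⟨hy, hyb⟩ => ?_) (subset_inter
    (uIcc_subset_uIcc left_mem_uIcc hhalf) ((ordConnected_lap b).uIcc_subset hp (half_mem_lap b)))
  rw [mem_uIcc] at *
  cases b <;> simp only [lap, mem_Iic, mem_Ici] at hp hyb <;> grind

theorem tent_eq_sub_abs (hs : 0 ≤ s) (x : ℝ) : tent s x = s / 2 - s * |x - 1 / 2| := by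
  rw [tent, ← mul_min_of_nonneg _ _ hs, min_def]
  split_ifs with h
  · rw [abs_of_nonpos (by linarith)]
    ring
  · rw [abs_of_nonneg (by linarith)]
    ring

theorem continuous_tent (s : ℝ) : Continuous (tent s) := by
  unfold tent
  fun_prop

theorem tent_le (hs : 0 ≤ s) (x : ℝ) : tent s x ≤ s / 2 := by
  rw [tent_eq_sub_abs hs]
  exact sub_le_self _ (by positivity)

theorem mapsTo_tent_Icc (hs : 0 ≤ s) (hs2 : s ≤ 2) :
    MapsTo (tent s) (Icc (0 : ℝ) 1) (Icc (0 : ℝ) 1) := fun x hx =>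
  ⟨le_min (mul_nonneg hs hx.1) (mul_nonneg hs (sub_nonneg.2 hx.2)),
    (tent_le hs x).trans (by linarith)⟩

theorem tent_of_le_half (hs : 0 ≤ s) {x : ℝ} (hx : x ≤ 1 / 2) : tent s x = s * x := by
  rw [tent_eq_sub_abs hs, abs_of_nonpos (sub_nonpos.2 hx)]
  ring

theorem tent_of_half_le (hs : 0 ≤ s) {x : ℝ} (hx : 1 / 2 ≤ x) : tent s x = s * (1 - x) := by
  rw [tent_eq_sub_abs hs, abs_of_nonneg (sub_nonneg.2 hx)]
  ring

theorem abs_tent_sub_tent_le (hs : 0 ≤ s) (x y : ℝ) : |tent s x - tent s y| ≤ s * |x - y| := by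
  have h : tent s x - tent s y = s * (|y - 1 / 2| - |x - 1 / 2|) := by
    rw [tent_eq_sub_abs hs, tent_eq_sub_abs hs]
    ring
  rw [h, abs_mul, abs_of_nonneg hs, abs_sub_comm x y, ← sub_sub_sub_cancel_right y x (1 / 2)]
  exact mul_le_mul_of_nonneg_left (abs_abs_sub_abs_le_abs_sub _ _) hs

theorem abs_iterate_tent_sub_le (hs : 0 ≤ s) (k : ℕ) (x y : ℝ) :
    |(tent s)^[k] x - (tent s)^[k] y| ≤ s ^ k * |x - y| := by
  have hlip : LipschitzWith s.toNNReal (tent s) := LipschitzWith.of_dist_le_mul fun x y => by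
    simpa only [Real.dist_eq, Real.coe_toNNReal s hs] using abs_tent_sub_tent_le hs x y
  simpa only [Real.dist_eq, NNReal.coe_pow, Real.coe_toNNReal s hs] using
    (hlip.iterate k).dist_le_mul x y

theorem abs_tent_sub_tent (hs : 0 ≤ s) {x y : ℝ} (hx : x ∈ lap b) (hy : y ∈ lap b) :
    |tent s x - tent s y| = s * |x - y| := by
  cases b
  · rw [tent_of_le_half hs hx, tent_of_le_half hs hy, ← mul_sub, abs_mul, abs_of_nonneg hs]
  · rw [tent_of_half_le hs hx, tent_of_half_le hs hy, ← mul_sub, abs_mul, abs_of_nonneg hs,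
      sub_sub_sub_cancel_left, abs_sub_comm]

theorem abs_tent_sub_tent_half (hs : 0 ≤ s) (x : ℝ) :
    |tent s x - tent s (1 / 2)| = s * |x - 1 / 2| :=
  let ⟨b, hb⟩ := exists_mem_lap x
  abs_tent_sub_tent hs hb (half_mem_lap b)

theorem injOn_tent_lap (hs : 0 < s) (b : Bool) : InjOn (tent s) (lap b) := by
  intro x hx y hy hxy
  have h := abs_tent_sub_tent hs.le hx hy
  rw [hxy, sub_self, abs_zero, zero_eq_mul, or_iff_right hs.ne', abs_eq_zero] at h
  exact sub_eq_zero.1 h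

theorem image_tent_uIcc (hs : 0 ≤ s) {x y : ℝ} (hx : x ∈ lap b) (hy : y ∈ lap b) :
    tent s '' uIcc x y = uIcc (tent s x) (tent s y) := by
  have hsub := (ordConnected_lap b).uIcc_subset hx hy
  cases b
  · have h : EqOn (tent s) (s * ·) (lap false) := fun z hz => tent_of_le_half hs hz
    rw [(h.mono hsub).image_eq, h hx, h hy, image_const_mul_uIcc]
  · have h : EqOn (tent s) (fun z => s * (1 - z)) (lap true) := fun z hz => tent_of_half_le hs hz
    rw [(h.mono hsub).image_eq, h hx, h hy, ← image_const_mul_uIcc, ← image_const_sub_uIcc,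
      image_image]

theorem ordConnected_image_tent {U : Set ℝ} (hU : OrdConnected U) :
    OrdConnected (tent s '' U) :=
  (hU.isPreconnected.image _ (continuous_tent s).continuousOn).ordConnected

theorem mul_diam_le_diam_image_tent (hs : 0 ≤ s) {U : Set ℝ} (hU : IsCompact U)
    (hlap : U ⊆ lap b) : s * Metric.diam U ≤ Metric.diam (tent s '' U) := by
  rcases hs.eq_or_lt with rfl | hs
  · simp [Metric.diam_nonneg]
  · rw [← le_div_iff₀' hs]
    refine Metric.diam_le_of_forall_dist_le (by positivity) fun x hx y hy => ?_
    rw [le_div_iff₀' hs, Real.dist_eq, ← abs_tent_sub_tent hs.le (hlap hx) (hlap hy)]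
    exact Metric.dist_le_diam_of_mem (hU.image (continuous_tent s)).isBounded
      (mem_image_of_mem _ hx) (mem_image_of_mem _ hy)

theorem half_mul_diam_le_diam_image_tent (hs : 0 ≤ s) {U : Set ℝ} (hU : IsCompact U)
    (hconn : OrdConnected U) : s / 2 * Metric.diam U ≤ Metric.diam (tent s '' U) := by
  rcases U.eq_empty_or_nonempty with rfl | ⟨x, hx⟩
  · simp
  by_cases hhalf : (1 / 2 : ℝ) ∈ U
  · have hdist : ∀ y ∈ U, s * dist y (1 / 2) ≤ Metric.diam (tent s '' U) := fun y hy => by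
      rw [Real.dist_eq, ← abs_tent_sub_tent_half hs]
      exact Metric.dist_le_diam_of_mem (hU.image (continuous_tent s)).isBounded
        (mem_image_of_mem _ hy) (mem_image_of_mem _ hhalf)
    rcases hs.eq_or_lt with rfl | hs
    · simp [Metric.diam_nonneg]
    · rw [← le_div_iff₀' (half_pos hs)]
      refine Metric.diam_le_of_forall_dist_le (by positivity) fun y hy z hz => ?_
      rw [le_div_iff₀' (half_pos hs)]
      have htri := mul_le_mul_of_nonneg_left (dist_triangle_right y z (1 / 2)) hs.le
      linarith [hdist y hy, hdist z hz]
  · obtain ⟨b, hb⟩ := exists_mem_lap x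
    have hexp := mul_diam_le_diam_image_tent hs hU (subset_lap_of_half_notMem hconn hhalf hx hb)
    have := mul_nonneg hs (Metric.diam_nonneg (s := U))
    linarith

/-! ### The critical orbit -/

theorem crit_zero (s : ℝ) : crit s 0 = 1 / 2 := rfl

theorem crit_succ (s : ℝ) (k : ℕ) : crit s (k + 1) = tent s (crit s k) :=
  Function.iterate_succ_apply' _ _ _

theorem crit_one (hs : 0 ≤ s) : crit s 1 = s / 2 := by
  rw [crit_succ, crit_zero, tent_of_le_half hs le_rfl]
  ring

theorem crit_two (hs1 : 1 ≤ s) : crit s 2 = s * (1 - s / 2) := by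
  rw [crit_succ, crit_one (by linarith), tent_of_half_le (by linarith) (by linarith)]

theorem half_lt_crit_one (hs1 : 1 < s) : 1 / 2 < crit s 1 := by
  rw [crit_one (by linarith)]
  linarith

theorem crit_two_lt_half (hs1 : 1 < s) : crit s 2 < 1 / 2 := by
  rw [crit_two hs1.le]
  linarith [sq_pos_of_pos (sub_pos.2 hs1)]

theorem crit_two_nonneg (hs1 : 1 ≤ s) (hs2 : s ≤ 2) : 0 ≤ crit s 2 := by
  rw [crit_two hs1]
  exact mul_nonneg (by linarith) (by linarith)

theorem crit_two_pos (hs1 : 1 ≤ s) (hs2 : s < 2) : 0 < crit s 2 := by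
  rw [crit_two hs1]
  exact mul_pos (by linarith) (by linarith)

theorem iterate_tent_crit (s : ℝ) (k n : ℕ) : (tent s)^[k] (crit s n) = crit s (n + k) := by
  rw [crit, crit, ← Function.iterate_add_apply, add_comm]

theorem abs_crit_add_sub_crit_le (hs : 0 ≤ s) (m k : ℕ) :
    |crit s (m + k) - crit s k| ≤ s ^ k * |crit s m - 1 / 2| := by
  rw [← iterate_tent_crit s k m]
  exact abs_iterate_tent_sub_le hs k _ _

theorem lt_two_of_infinite_range_crit (hs2 : s ≤ 2) (hinf : (range (crit s)).Infinite) :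
    s < 2 := by
  refine hs2.lt_of_ne ?_
  rintro rfl
  refine hinf ((toFinite {1 / 2, 1, 0}).subset (range_subset_iff.2 fun n => ?_))
  induction n with
  | zero => exact Or.inl rfl
  | succ n ih =>
    rw [crit_succ]
    rcases ih with h | h | h <;> rw [h] <;> norm_num [tent]

/-- Near-returns of `c` can be concatenated, so a single near-return at every scale already makes
`c` recurrent, also when `c` is periodic. -/
theorem critRecurrent_iff (hs : 0 < s) :
    CritRecurrent s ↔ ∀ ε > 0, ∃ k ≥ 1, |crit s k - 1 / 2| < ε := by
  rw [CritRecurrent, Metric.nhds_basis_ball.mapClusterPt_iff_frequently]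
  simp only [frequently_atTop, Metric.mem_ball, Real.dist_eq]
  refine ⟨fun h ε hε => h ε hε 1, fun h ε hε N => ?_⟩
  induction N generalizing ε with
  | zero => exact (h ε hε).imp fun k hk => ⟨Nat.zero_le k, hk.2⟩
  | succ N ih =>
    obtain ⟨k, hkN, hk⟩ := ih (ε / 2) (half_pos hε)
    obtain ⟨m, hm1, hm⟩ := h (ε / 2 / s ^ k) (by positivity)
    refine ⟨m + k, by omega, ?_⟩
    rw [lt_div_iff₀' (by positivity)] at hm
    have htri := abs_sub_le (crit s (m + k)) (crit s k) (1 / 2)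
    linarith [abs_crit_add_sub_crit_le hs.le m k]

theorem core_subset_Icc (hs1 : 1 ≤ s) (hs2 : s ≤ 2) : Icc (crit s 2) (crit s 1) ⊆ Icc 0 1 :=
  Icc_subset_Icc (crit_two_nonneg hs1 hs2) (by rw [crit_one (by linarith)]; linarith)

theorem mapsTo_tent_core (hs1 : 1 ≤ s) (hs2 : s ≤ 2) :
    MapsTo (tent s) (Icc (crit s 2) (crit s 1)) (Icc (crit s 2) (crit s 1)) := by
  intro x hx
  have hs : 0 ≤ s := by linarith
  refine ⟨le_min ?_ ?_, (tent_le hs x).trans_eq (crit_one hs).symm⟩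
  · exact hx.1.trans (le_mul_of_one_le_left ((crit_two_nonneg hs1 hs2).trans hx.1) hs1)
  · rw [crit_two hs1, ← crit_one hs]
    exact mul_le_mul_of_nonneg_left (by linarith [hx.2]) hs

theorem crit_mem_core (hs1 : 1 < s) (hs2 : s ≤ 2) (k : ℕ) :
    crit s k ∈ Icc (crit s 2) (crit s 1) :=
  (mapsTo_tent_core hs1.le hs2).iterate k ⟨(crit_two_lt_half hs1).le, (half_lt_crit_one hs1).le⟩

theorem core_subset_image_tent (hs1 : 1 < s) :
    Icc (crit s 2) (crit s 1) ⊆ tent s '' Icc (1 / 2) (crit s 1) := by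
  rw [← uIcc_of_le (half_lt_crit_one hs1).le,
    image_tent_uIcc (b := true) (by linarith) self_mem_Ici (half_lt_crit_one hs1).le,
    ← crit_succ s 1, ← crit_zero s, ← crit_succ s 0, uIcc_comm]
  exact Icc_subset_uIcc

/-! ### The inverse limit -/

/-- The projection `π_n(H)` of a set of sequences to the coordinate `n`. -/
def proj (n : ℕ) (H : Set (ℕ → ℝ)) : Set ℝ := (fun x => x n) '' H

section InverseLimit

variable {J : Set ℝ} {x y : ℕ → ℝ} {A B : Set (ℕ → ℝ)}

theorem iterate_tent_invLim (hx : x ∈ invLim s J) (n k : ℕ) : (tent s)^[k] (x (n + k)) = x n := by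
  induction k with
  | zero => rfl
  | succ k ih => rw [Function.iterate_succ_apply, ← add_assoc, hx.2, ih]

theorem eq_of_le_of_eq (hx : x ∈ invLim s J) (hy : y ∈ invLim s J) {n i : ℕ} (h : x n = y n)
    (hi : i ≤ n) : x i = y i := by
  obtain ⟨k, rfl⟩ := Nat.exists_eq_add_of_le hi
  rw [← iterate_tent_invLim hx i k, ← iterate_tent_invLim hy i k, h]

theorem tail_mem_invLim (hx : x ∈ invLim s J) (k : ℕ) : (fun i => x (i + k)) ∈ invLim s J :=
  ⟨fun i => hx.1 (i + k), fun i => by simpa only [add_right_comm] using hx.2 (i + k)⟩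

theorem le_half_of_mem_invLim (hs : 0 ≤ s) (hx : x ∈ invLim s J) (n : ℕ) : x n ≤ s / 2 :=
  (hx.2 n).symm.trans_le (tent_le hs _)

theorem coreSpace_subset_space (hs1 : 1 ≤ s) (hs2 : s ≤ 2) : coreSpace s ⊆ space s :=
  fun _ hx => ⟨fun i => core_subset_Icc hs1 hs2 (hx.1 i), hx.2⟩

theorem proj_eq_image_tent_proj_succ (hA : A ⊆ invLim s J) (n : ℕ) :
    proj n A = tent s '' proj (n + 1) A := by
  rw [proj, proj, image_image]
  exact image_congr fun x hx => ((hA hx).2 n).symm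

theorem isCompact_proj (hA : IsCompact A) (n : ℕ) : IsCompact (proj n A) :=
  hA.image (continuous_apply n)

theorem ordConnected_proj (hA : IsPreconnected A) (n : ℕ) : OrdConnected (proj n A) :=
  (hA.image _ (continuous_apply n).continuousOn).ordConnected

theorem mem_of_forall_mem_proj (hB : IsClosed B) (hBJ : B ⊆ invLim s J) (hx : x ∈ invLim s J)
    (h : ∀ n, x n ∈ proj n B) : x ∈ B := by
  choose b hb hbx using h
  refine hB.mem_of_tendsto (tendsto_pi_nhds.2 fun i => ?_) (Eventually.of_forall (f := atTop) hb)
  refine tendsto_const_nhds.congr' ?_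
  filter_upwards [eventually_ge_atTop i] with n hn
  exact (eq_of_le_of_eq (hBJ (hb n)) hx (hbx n) hn).symm

theorem exists_eventually_le_pow_mul_abs_sub (hs : 0 < s) (hAJ : A ⊆ invLim s J)
    (hB : IsCompact B) (hBJ : B ⊆ invLim s J) (h : ¬A ⊆ B) :
    ∃ α > 0, ∃ a ∈ A, ∀ᶠ m in atTop, ∀ y ∈ proj m B, α ≤ s ^ m * |a m - y| := by
  obtain ⟨a, ha, haB⟩ := not_subset.1 h
  obtain ⟨N, hN⟩ : ∃ N, a N ∉ proj N B := by
    by_contra! hcon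
    exact haB (mem_of_forall_mem_proj hB.isClosed hBJ (hAJ ha) hcon)
  obtain ⟨ε, hε, hball⟩ :=
    Metric.isOpen_iff.1 (isCompact_proj hB N).isClosed.isOpen_compl _ hN
  refine ⟨s ^ N * ε, by positivity, a, ha, ?_⟩
  filter_upwards [eventually_ge_atTop N]
  rintro m hm _ ⟨b, hb, rfl⟩
  obtain ⟨k, rfl⟩ := Nat.exists_eq_add_of_le hm
  have hsep : ε ≤ |a N - b N| := by
    by_contra! hlt
    exact hball (by rwa [Metric.mem_ball, Real.dist_eq, abs_sub_comm]) ⟨b, hb, rfl⟩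
  have hlip := abs_iterate_tent_sub_le hs.le k (a (N + k)) (b (N + k))
  rw [iterate_tent_invLim (hAJ ha), iterate_tent_invLim (hBJ hb)] at hlip
  rw [pow_add, mul_assoc]
  exact mul_le_mul_of_nonneg_left (hsep.trans hlip) (by positivity)

/-- Points of `A \ B` and `B \ A` stay at distance of order `s ^ (-m)` from `B` and `A` in the
coordinate `m`. Since there is no room for them above `x m`, both lie below it, and then the lower
one traps the other one in an interval. -/
theorem mem_endpoints_of_frequently (hs : 0 < s) (hx : x ∈ space s)
    (h : ∀ α > 0, ∃ᶠ m in atTop, s ^ m * (s / 2 - x m) < α) : x ∈ endpoints (space s) := by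
  refine ⟨hx, fun A B hA hB hxA hxB => ?_⟩
  by_contra! hcon
  obtain ⟨α, hα, a, ha, hαB⟩ :=
    exists_eventually_le_pow_mul_abs_sub hs hA.1 hB.2.1 hB.1 hcon.1
  obtain ⟨β, hβ, b, hb, hβA⟩ :=
    exists_eventually_le_pow_mul_abs_sub hs hB.1 hA.2.1 hA.1 hcon.2
  obtain ⟨m, hlt, hαB, hβA⟩ := ((h (min α β) (lt_min hα hβ)).and_eventually (hαB.and hβA)).exists
  have below : ∀ y ∈ space s, min α β ≤ s ^ m * |y m - x m| → y m ≤ x m := by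
    intro y hy hyx
    by_contra! hlt'
    rw [abs_of_pos (sub_pos.2 hlt')] at hyx
    have := mul_le_mul_of_nonneg_left (sub_le_sub_right (le_half_of_mem_invLim hs.le hy m) (x m))
      (pow_pos hs m).le
    linarith
  have notMem_of_le {γ t : ℝ} {U : Set ℝ} (hγ : 0 < γ) (hU : ∀ y ∈ U, γ ≤ s ^ m * |t - y|) :
      t ∉ U := fun ht => by
    have := hU t ht
    rw [sub_self, abs_zero, mul_zero] at this
    exact this.not_gt hγ
  have hax := below a (hA.1 ha) ((min_le_left _ _).trans (hαB _ ⟨x, hxB, rfl⟩))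
  have hbx := below b (hB.1 hb) ((min_le_right _ _).trans (hβA _ ⟨x, hxA, rfl⟩))
  rcases le_total (a m) (b m) with hab | hab
  · exact notMem_of_le hβ hβA
      ((ordConnected_proj hA.2.2.isPreconnected m).out ⟨a, ha, rfl⟩ ⟨x, hxA, rfl⟩ ⟨hab, hbx⟩)
  · exact notMem_of_le hα hαB
      ((ordConnected_proj hB.2.2.isPreconnected m).out ⟨b, hb, rfl⟩ ⟨x, hxB, rfl⟩ ⟨hab, hax⟩)

end InverseLimit

/-! ### Recurrence produces an endpoint -/

theorem exists_strictMono_near_returns (hs : 0 < s) (hrec : CritRecurrent s) :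
    ∃ n : ℕ → ℕ, StrictMono n ∧
      ∀ i, s ^ n i * |crit s (n (i + 1) - n i) - 1 / 2| ≤ 1 / 2 ^ (i + 1) := by
  have near : ∀ i m : ℕ, ∃ k ≥ 1, s ^ m * |crit s k - 1 / 2| ≤ 1 / 2 ^ (i + 1) := by
    intro i m
    obtain ⟨k, hk1, hk⟩ := (critRecurrent_iff hs).1 hrec (1 / 2 ^ (i + 1) / s ^ m) (by positivity)
    exact ⟨k, hk1, ((lt_div_iff₀' (by positivity)).1 hk).le⟩
  choose k hk1 hk using near
  refine ⟨fun i => Nat.rec 0 (fun i m => m + k i m) i, strictMono_nat_of_lt_succ fun i => ?_,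
    fun i => ?_⟩
  · exact Nat.lt_add_of_pos_right (hk1 _ _)
  · simpa only [add_tsub_cancel_left] using hk i _

theorem pow_mul_abs_crit_sub_half_le (hs : 0 < s) {n : ℕ → ℕ} (hn : StrictMono n)
    (hret : ∀ i, s ^ n i * |crit s (n (i + 1) - n i) - 1 / 2| ≤ 1 / 2 ^ (i + 1)) {r l : ℕ}
    (hrl : r ≤ l) : s ^ n r * |crit s (n l - n r) - 1 / 2| ≤ 1 / 2 ^ r - 1 / 2 ^ l := by
  induction l, hrl using Nat.le_induction with
  | base => simp [crit_zero]
  | succ l hrl ih =>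
    have hrl' := hn.monotone hrl
    have hll : n l < n (l + 1) := hn l.lt_succ_self
    have hstep : s ^ n r * |crit s (n (l + 1) - n r) - crit s (n l - n r)| ≤ 1 / 2 ^ (l + 1) := by
      refine le_trans ?_ (hret l)
      have h := abs_crit_add_sub_crit_le hs.le (n (l + 1) - n l) (n l - n r)
      rw [show n (l + 1) - n l + (n l - n r) = n (l + 1) - n r by omega] at h
      calc _ ≤ s ^ n r * (s ^ (n l - n r) * |crit s (n (l + 1) - n l) - 1 / 2|) := by gcongr
        _ = _ := by rw [← mul_assoc, ← pow_add, Nat.add_sub_cancel' hrl']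
    have htri := mul_le_mul_of_nonneg_left (abs_sub_le (crit s (n (l + 1) - n r))
      (crit s (n l - n r)) (1 / 2)) (pow_pos hs (n r)).le
    have hgeom : (1 : ℝ) / 2 ^ l = 1 / 2 ^ (l + 1) + 1 / 2 ^ (l + 1) := by
      field_simp
      ring
    linarith

/-- The point is a limit of the backward orbits `c_{n_i}, c_{n_i - 1}, …, c` of a sequence of
faster and faster near-returns. -/
theorem exists_mem_coreSpace_near_half (hs1 : 1 < s) (hs2 : s ≤ 2) (hrec : CritRecurrent s) :
    ∃ x ∈ coreSpace s, ∃ n : ℕ → ℕ, StrictMono n ∧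
      ∀ r, s ^ n r * |x (n r) - 1 / 2| ≤ 1 / 2 ^ r := by
  have hs : 0 < s := by linarith
  obtain ⟨n, hn, hret⟩ := exists_strictMono_near_returns hs hrec
  obtain ⟨x, hx, φ, hφ, hlim⟩ := (isCompact_univ_pi fun _ => isCompact_Icc).tendsto_subseq
    (x := fun i j => crit s (n i - j)) fun i j _ => crit_mem_core hs1 hs2 (n i - j)
  have hlim (j : ℕ) : Tendsto (fun i => crit s (n (φ i) - j)) atTop (𝓝 (x j)) :=
    tendsto_pi_nhds.1 hlim j
  have hle (i : ℕ) : i ≤ n (φ i) := (hn.comp hφ).le_apply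
  refine ⟨x, ⟨fun j => hx j (mem_univ j), fun j => ?_⟩, n, hn, fun r => ?_⟩
  · refine tendsto_nhds_unique (((continuous_tent s).tendsto _).comp (hlim (j + 1)))
      ((hlim j).congr' ?_)
    filter_upwards [eventually_ge_atTop (j + 1)] with i hi
    have := hle i
    rw [Function.comp_apply, ← crit_succ]
    congr 1
    omega
  · refine le_of_tendsto (((hlim (n r)).sub_const (1 / 2)).abs.const_mul (s ^ n r)) ?_
    filter_upwards [eventually_ge_atTop r] with i hi
    refine (pow_mul_abs_crit_sub_half_le hs hn hret (hi.trans hφ.le_apply)).trans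
      (sub_le_self _ (by positivity))

theorem CritRecurrent.exists_endpoint (hs1 : 1 < s) (hs2 : s ≤ 2) (hrec : CritRecurrent s) :
    (endpoints (space s) ∩ coreSpace s).Nonempty := by
  have hs : 0 < s := by linarith
  obtain ⟨x, hx, n, hn, hnear⟩ := exists_mem_coreSpace_near_half hs1 hs2 hrec
  refine ⟨x, mem_endpoints_of_frequently hs (coreSpace_subset_space hs1.le hs2 hx)
    fun α hα => frequently_atTop.2 fun N => ?_, hx⟩
  obtain ⟨i, hi⟩ := exists_pow_lt_of_lt_one hα one_half_lt_one
  obtain ⟨m, hm⟩ : ∃ m, n (N + i + 1) = m + 1 :=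
    Nat.exists_eq_succ_of_ne_zero (Nat.zero_lt_succ _ |>.trans_le hn.le_apply).ne'
  refine ⟨m, by have : N + i + 1 ≤ n (N + i + 1) := hn.le_apply; omega, ?_⟩
  calc s ^ m * (s / 2 - x m) = s ^ (m + 1) * |x (m + 1) - 1 / 2| := by
        rw [← hx.2 m, tent_eq_sub_abs hs.le]
        ring
    _ ≤ 1 / 2 ^ (N + i + 1) := hm ▸ hnear (N + i + 1)
    _ ≤ (1 / 2) ^ i := by
        rw [← one_div_pow]
        exact pow_le_pow_of_le_one (by norm_num) (by norm_num) (by omega)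
    _ < α := hi

/-! ### Inverse branches -/

/-- The affine inverse of the restriction of `T` to the lap `b`. -/
noncomputable def invBranch (s : ℝ) : Bool → ℝ → ℝ
  | false, t => t / s
  | true, t => 1 - t / s

/-- The backward orbit of `t` along the inverse branches coded by `e`; it is the only candidate for
a point of the inverse limit with left itinerary `e` and coordinate `t` at `0`. -/
noncomputable def branch (s : ℝ) (e : ℕ → Bool) (t : ℝ) : ℕ → ℝ
  | 0 => t
  | n + 1 => invBranch s (e n) (branch s e t n)

section Branch

variable {e : ℕ → Bool} {t : ℝ} {n : ℕ}

theorem isLeftItinerary_iff {x : ℕ → ℝ} : IsLeftItinerary x e ↔ ∀ i, x (i + 1) ∈ lap (e i) := by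
  refine forall_congr' fun i => ?_
  cases e i <;> simp [lap]

theorem exists_isLeftItinerary (x : ℕ → ℝ) : ∃ e, IsLeftItinerary x e := by
  choose e he using fun i => exists_mem_lap (x (i + 1))
  exact ⟨e, isLeftItinerary_iff.2 he⟩

theorem tent_invBranch (hs : 0 < s) (h : invBranch s b t ∈ lap b) :
    tent s (invBranch s b t) = t := by
  cases b
  · rw [tent_of_le_half hs.le h, invBranch, mul_div_cancel₀ _ hs.ne']
  · rw [tent_of_half_le hs.le h, invBranch, sub_sub_cancel, mul_div_cancel₀ _ hs.ne']

theorem invBranch_tent (hs : 0 < s) (h : t ∈ lap b) : invBranch s b (tent s t) = t := by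
  cases b
  · rw [tent_of_le_half hs.le h, invBranch, mul_div_cancel_left₀ _ hs.ne']
  · rw [tent_of_half_le hs.le h, invBranch, mul_div_cancel_left₀ _ hs.ne', sub_sub_cancel]

theorem abs_invBranch_sub (hs : 0 < s) (b : Bool) (t u : ℝ) :
    |invBranch s b t - invBranch s b u| = |t - u| / s := by
  cases b
  · rw [invBranch, invBranch, ← sub_div, abs_div, abs_of_pos hs]
  · rw [invBranch, invBranch, sub_sub_sub_cancel_left, ← sub_div, abs_div, abs_of_pos hs,
      abs_sub_comm]

theorem continuous_branch (s : ℝ) (e : ℕ → Bool) : Continuous (branch s e) := by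
  refine continuous_pi fun n => ?_
  induction n with
  | zero => exact continuous_id
  | succ n ih => cases h : e n <;> simp only [branch, invBranch, h] <;> fun_prop

theorem injective_branch (s : ℝ) (e : ℕ → Bool) : Function.Injective (branch s e) :=
  fun _ _ h => congrFun h 0

theorem abs_branch_sub (hs : 0 < s) (e : ℕ → Bool) (t u : ℝ) (n : ℕ) :
    |branch s e t n - branch s e u n| = |t - u| / s ^ n := by
  induction n with
  | zero => simp [branch]
  | succ n ih => rw [branch, branch, abs_invBranch_sub hs, ih, pow_succ, div_div]

theorem tent_branch (hs : 0 < s) (h : branch s e t (n + 1) ∈ lap (e n)) :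
    tent s (branch s e t (n + 1)) = branch s e t n :=
  tent_invBranch hs h

theorem iterate_tent_branch (hs : 0 < s) (h : ∀ i < n, branch s e t (i + 1) ∈ lap (e i)) :
    (tent s)^[n] (branch s e t n) = t := by
  induction n with
  | zero => rfl
  | succ n ih =>
    rw [Function.iterate_succ_apply, tent_branch hs (h n n.lt_succ_self)]
    exact ih fun i hi => h i (hi.trans n.lt_succ_self)

theorem branch_tent (hs : 0 < s) (h : t ∈ lap (e 0)) (n : ℕ) :
    branch s e (tent s t) (n + 1) = branch s (fun i => e (i + 1)) t n := by
  induction n with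
  | zero => exact invBranch_tent hs h
  | succ n ih => rw [branch, ih, branch]

theorem branch_apply_zero (hs : 0 < s) {J : Set ℝ} {x : ℕ → ℝ} (hx : x ∈ invLim s J)
    (he : IsLeftItinerary x e) : branch s e (x 0) = x := by
  ext n
  induction n with
  | zero => rfl
  | succ n ih => rw [branch, ih, ← hx.2 n, invBranch_tent hs (isLeftItinerary_iff.1 he n)]

theorem branch_mem_space (hs : 0 < s) (hs2 : s ≤ 2) (h0 : ∀ n, 0 ≤ branch s e t n)
    (h : IsLeftItinerary (branch s e t) e) : branch s e t ∈ space s := by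
  have htent (n : ℕ) := tent_branch hs (isLeftItinerary_iff.1 h n)
  exact ⟨fun n => ⟨h0 n, by linarith [htent n, tent_le hs.le (branch s e t (n + 1))]⟩, htent⟩

theorem isSubcontinuum_branch_image {p q : ℝ} (hpq : p ≤ q)
    (h : ∀ u ∈ Icc p q, branch s e u ∈ space s) :
    IsSubcontinuum (branch s e '' Icc p q) (space s) :=
  ⟨image_subset_iff.2 h, isCompact_Icc.image (continuous_branch s e),
    (isConnected_Icc hpq).image _ (continuous_branch s e).continuousOn⟩

theorem branch_notMem_endpoints {p q : ℝ} (hpt : p < t) (htq : t < q)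
    (h : ∀ u ∈ Icc p q, branch s e u ∈ space s) : branch s e t ∉ endpoints (space s) := by
  intro hend
  have hnested := hend.2 _ _
    (isSubcontinuum_branch_image hpt.le fun u hu => h u ⟨hu.1, hu.2.trans htq.le⟩)
    (isSubcontinuum_branch_image htq.le fun u hu => h u ⟨hpt.le.trans hu.1, hu.2⟩)
    (mem_image_of_mem _ (right_mem_Icc.2 hpt.le)) (mem_image_of_mem _ (left_mem_Icc.2 htq.le))
  rw [image_subset_image_iff (injective_branch s e),
    image_subset_image_iff (injective_branch s e)] at hnested
  rcases hnested with hsub | hsub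
  · exact (hsub (left_mem_Icc.2 hpt.le)).1.not_gt hpt
  · exact (hsub (right_mem_Icc.2 htq.le)).2.not_gt htq

end Branch

/-! ### Endpoints in the core force recurrence -/

/-- While the inverse branches along `e` stay in the right laps, they are inverse to the iterates of
`T`. The first of them to leave its lap does so across `c`. -/
theorem exists_crit_eq_of_not_isLeftItinerary (hs : 0 < s) {e : ℕ → Bool} {I : Set ℝ}
    (hI : OrdConnected I) {t t' : ℝ} (ht : t ∈ I) (he : IsLeftItinerary (branch s e t) e)
    (ht' : t' ∈ I) (he' : ¬IsLeftItinerary (branch s e t') e) :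
    ∃ k ≥ 1, crit s k ∈ I ∧ branch s e (crit s k) k = 1 / 2 := by
  rw [isLeftItinerary_iff] at he
  rw [isLeftItinerary_iff, not_forall] at he'
  have hleave : ∃ n, ∃ v ∈ I, branch s e v (n + 1) ∉ lap (e n) :=
    he'.imp fun n hn => ⟨t', ht', hn⟩
  classical
  set n := Nat.find hleave
  obtain ⟨v, hv, hvn⟩ := Nat.find_spec hleave
  have hstay : ∀ i < n, ∀ u ∈ I, branch s e u (i + 1) ∈ lap (e i) := fun i hi u hu => by
    by_contra hui
    exact Nat.find_min hleave hi ⟨u, hu, hui⟩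
  have hhalf : (1 / 2 : ℝ) ∈ uIcc (branch s e t (n + 1)) (branch s e v (n + 1)) := by
    by_contra hnot
    exact hvn (subset_lap_of_half_notMem ordConnected_uIcc hnot left_mem_uIcc (he n)
      right_mem_uIcc)
  obtain ⟨u, hu, hun : branch s e u (n + 1) = 1 / 2⟩ := intermediate_value_uIcc
    ((continuous_apply (n + 1)).comp (continuous_branch s e)).continuousOn hhalf
  have huI : u ∈ I := hI.uIcc_subset ht hv hu
  have hcrit : crit s (n + 1) = u := by
    rw [crit, ← hun]
    refine iterate_tent_branch hs fun i hi => ?_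
    rcases Nat.lt_succ_iff_lt_or_eq.1 hi with hi | rfl
    · exact hstay i hi u huI
    · exact hun ▸ half_mem_lap _
  exact ⟨n + 1, n.succ_pos, hcrit ▸ huI, hcrit ▸ hun⟩

theorem exists_crit_near_of_mem_endpoints (hs1 : 1 < s) (hs2 : s < 2) {x : ℕ → ℝ}
    (hx : x ∈ coreSpace s) (hend : x ∈ endpoints (space s)) {ε : ℝ} (hε : 0 < ε) :
    ∃ k ≥ 1, |crit s k - x 0| ≤ ε ∧ |x k - 1 / 2| ≤ ε := by
  have hs : 0 < s := by linarith
  obtain ⟨e, he⟩ := exists_isLeftItinerary x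
  have hbranch := branch_apply_zero hs hx he
  set η := min ε (crit s 2)
  have hη : 0 < η := lt_min hε (crit_two_pos hs1.le hs2)
  have hdist : ∀ t ∈ Icc (x 0 - η) (x 0 + η), ∀ n, |branch s e t n - x n| ≤ η := by
    intro t ht n
    rw [← congrFun hbranch n, abs_branch_sub hs]
    exact (div_le_self (abs_nonneg _) (one_le_pow₀ hs1.le)).trans (abs_sub_le_iff.2
      ⟨by linarith [ht.2], by linarith [ht.1]⟩)
  obtain ⟨t, ht, hte⟩ : ∃ t ∈ Icc (x 0 - η) (x 0 + η), ¬IsLeftItinerary (branch s e t) e := by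
    by_contra! hall
    refine branch_notMem_endpoints (s := s) (e := e) (t := x 0) (sub_lt_self _ hη)
      (lt_add_of_pos_right _ hη) (fun t ht => ?_) (hbranch.symm ▸ hend)
    refine branch_mem_space hs hs2.le (fun n => ?_) (hall t ht)
    linarith [(abs_le.1 (hdist t ht n)).1, (hx.1 n).1, min_le_right ε (crit s 2)]
  obtain ⟨k, hk1, hkI, hk⟩ := exists_crit_eq_of_not_isLeftItinerary hs ordConnected_Icc
    (t := x 0) ⟨by linarith, by linarith⟩ (hbranch.symm ▸ he) ht hte
  refine ⟨k, hk1, (hdist _ hkI 0).trans (min_le_left _ _), ?_⟩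
  rw [abs_sub_comm, ← hk]
  exact (hdist _ hkI k).trans (min_le_left _ _)

theorem mem_endpoints_of_injective {E F : Type*} [TopologicalSpace E] [TopologicalSpace F]
    {g : E → F} (hg : Continuous g) (hinj : Function.Injective g) {K : Set E} {L : Set F}
    (hKL : MapsTo g K L) {x : E} (hxK : x ∈ K) (hx : g x ∈ endpoints L) : x ∈ endpoints K := by
  have himage : ∀ A, IsSubcontinuum A K → IsSubcontinuum (g '' A) L := fun A hA =>
    ⟨(hKL.mono_left hA.1).image_subset, hA.2.1.image hg, hA.2.2.image _ hg.continuousOn⟩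
  refine ⟨hxK, fun A B hA hB hxA hxB => ?_⟩
  rw [← image_subset_image_iff hinj, ← image_subset_image_iff hinj]
  exact hx.2 _ _ (himage A hA) (himage B hB) (mem_image_of_mem g hxA) (mem_image_of_mem g hxB)

/-- The shift homeomorphism of the inverse limit induced by `T`; its inverse forgets the coordinate
`0`. -/
def shift (s : ℝ) (x : ℕ → ℝ) : ℕ → ℝ
  | 0 => tent s (x 0)
  | n + 1 => x n

theorem continuous_shift (s : ℝ) : Continuous (shift s) := by
  refine continuous_pi fun n => ?_
  cases n with
  | zero => exact (continuous_tent s).comp (continuous_apply 0)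
  | succ n => exact continuous_apply n

theorem injective_shift (s : ℝ) : Function.Injective (shift s) :=
  fun _ _ h => funext fun n => congrFun h (n + 1)

section Tail

variable {J : Set ℝ} {x : ℕ → ℝ}

theorem mapsTo_shift_invLim (hJ : MapsTo (tent s) J J) :
    MapsTo (shift s) (invLim s J) (invLim s J) := by
  refine fun x hx => ⟨fun n => ?_, fun n => ?_⟩
  · cases n with
    | zero => exact hJ (hx.1 0)
    | succ n => exact hx.1 n
  · cases n with
    | zero => rfl
    | succ n => exact hx.2 n

theorem shift_tail (hx : x ∈ invLim s J) : shift s (fun i => x (i + 1)) = x := by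
  ext n
  cases n with
  | zero => exact hx.2 0
  | succ n => rfl

theorem tail_mem_endpoints (hJ : MapsTo (tent s) J J) (hx : x ∈ endpoints (invLim s J)) (k : ℕ) :
    (fun i => x (i + k)) ∈ endpoints (invLim s J) := by
  induction k with
  | zero => exact hx
  | succ k ih =>
    refine mem_endpoints_of_injective (continuous_shift s) (injective_shift s)
      (mapsTo_shift_invLim hJ) (tail_mem_invLim hx.1 (k + 1)) ?_
    convert ih using 1
    simpa only [add_assoc, add_comm 1 k] using shift_tail ih.1

end Tail

theorem critRecurrent_of_exists_endpoint (hs1 : 1 < s) (hs2 : s < 2)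
    (h : (endpoints (space s) ∩ coreSpace s).Nonempty) : CritRecurrent s := by
  obtain ⟨x, hend, hx⟩ := h
  refine (critRecurrent_iff (by linarith)).2 fun ε hε => ?_
  obtain ⟨m, -, -, hm⟩ := exists_crit_near_of_mem_endpoints hs1 hs2 hx hend (ε := ε / 3)
    (by positivity)
  obtain ⟨k, hk1, hk, -⟩ := exists_crit_near_of_mem_endpoints hs1 hs2 (tail_mem_invLim hx m)
    (tail_mem_endpoints (mapsTo_tent_Icc (by linarith) hs2.le) hend m) (ε := ε / 3)
    (by positivity)
  rw [zero_add] at hk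
  exact ⟨k, hk1, by linarith [abs_sub_le (crit s k) (x m) (1 / 2)]⟩

/-! ### Levels of the Hofbauer tower -/

theorem D_zero (hs1 : 1 < s) : D s 0 = Icc (1 / 2) (crit s 1) :=
  uIcc_of_le (half_lt_crit_one hs1).le

theorem D_succ_of_mem {n : ℕ} (h : (1 / 2 : ℝ) ∈ D s n) :
    D s (n + 1) = uIcc (crit s (n + 2)) (crit s 1) := by
  rw [D, if_pos h]

theorem D_succ_of_notMem {n : ℕ} (h : (1 / 2 : ℝ) ∉ D s n) : D s (n + 1) = tent s '' D s n := by
  rw [D, if_neg h]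

theorem exists_D_eq_uIcc (hs : 0 ≤ s) (n : ℕ) : ∃ r, D s n = uIcc (crit s (n + 1)) r := by
  induction n with
  | zero => exact ⟨1 / 2, by rw [D, uIcc_comm]⟩
  | succ n ih =>
    by_cases h : (1 / 2 : ℝ) ∈ D s n
    · exact ⟨_, D_succ_of_mem h⟩
    · obtain ⟨r, hr⟩ := ih
      obtain ⟨b, hb⟩ := exists_mem_lap r
      have hsub := subset_lap_of_half_notMem ordConnected_uIcc (hr ▸ h) right_mem_uIcc hb
      exact ⟨tent s r, by
        rw [D_succ_of_notMem h, hr, image_tent_uIcc hs (hsub left_mem_uIcc) hb, ← crit_succ]⟩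

theorem image_tent_D_inter_lap_subset (hs : 0 ≤ s) {n : ℕ} (hb : crit s (n + 1) ∈ lap b)
    (hne : crit s (n + 1) ≠ 1 / 2) : tent s '' (D s n ∩ lap b) ⊆ D s (n + 1) := by
  by_cases h : (1 / 2 : ℝ) ∈ D s n
  · obtain ⟨r, hr⟩ := exists_D_eq_uIcc hs n
    rw [D_succ_of_mem h, hr, uIcc_inter_lap hb hne (hr ▸ h),
      image_tent_uIcc hs hb (half_mem_lap b), ← crit_succ, ← crit_zero s, ← crit_succ]
  · rw [D_succ_of_notMem h]
    exact image_mono inter_subset_left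

theorem diam_uIcc (p q : ℝ) : Metric.diam (uIcc p q) = |p - q| := by
  rw [uIcc, Real.diam_Icc min_le_max, max_sub_min_eq_abs, abs_sub_comm]

section LongBranched

variable {δ : ℝ} (hδ : ∀ n, δ ≤ Metric.diam (D s n))
include hδ

theorem le_mul_abs_crit_sub_half (hs : 0 ≤ s) {n : ℕ} (h : (1 / 2 : ℝ) ∈ D s n) :
    δ ≤ s * |crit s (n + 1) - 1 / 2| := by
  rw [← abs_tent_sub_tent_half hs, ← crit_succ, ← crit_zero s, ← crit_succ, ← diam_uIcc,
    ← D_succ_of_mem h]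
  exact hδ (n + 1)

theorem crit_succ_ne_half (hs : 0 ≤ s) (hpos : 0 < δ) (n : ℕ) : crit s (n + 1) ≠ 1 / 2 := by
  intro h
  obtain ⟨r, hr⟩ := exists_D_eq_uIcc hs n
  have hle := le_mul_abs_crit_sub_half hδ hs (n := n) (hr ▸ h ▸ left_mem_uIcc)
  rw [h, sub_self, abs_zero, mul_zero] at hle
  exact hle.not_gt hpos

end LongBranched

/-- The part of `U` on the same side of `c` as `c_{a+1}` lies in the level `D_{a+1}` of the
tower. This is what remains of a bound of `U` by the tower once `U` is cut at `c`. -/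
def BoundedByLevel (s : ℝ) (a : ℕ) (U : Set ℝ) : Prop :=
  ∀ b, crit s (a + 1) ∈ lap b → U ∩ lap b ⊆ D s a

namespace BoundedByLevel

variable {a : ℕ} {U : Set ℝ}

theorem zero (hs1 : 1 < s) (hU : U ⊆ Iic (s / 2)) : BoundedByLevel s 0 U := by
  intro b hb
  cases b
  · exact absurd hb (half_lt_crit_one hs1).not_ge
  · rw [D_zero hs1, crit_one (by linarith)]
    exact fun y hy => ⟨hy.2, hU hy.1⟩

theorem image_tent (h : BoundedByLevel s a U) (hs : 0 ≤ s) (hb : crit s (a + 1) ∈ lap b)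
    (hne : crit s (a + 1) ≠ 1 / 2) : BoundedByLevel s (a + 1) (tent s '' (U ∩ lap b)) :=
  fun _ _ => inter_subset_left.trans <|
    (image_mono (subset_inter (h b hb) inter_subset_right)).trans
      (image_tent_D_inter_lap_subset hs hb hne)

theorem half_mem_D (h : BoundedByLevel s a U) (hU : (1 / 2 : ℝ) ∈ U) : (1 / 2 : ℝ) ∈ D s a :=
  let ⟨b, hb⟩ := exists_mem_lap (crit s (a + 1))
  h b hb ⟨hU, half_mem_lap b⟩

end BoundedByLevel

/-! ### Proper subcontinua of the core -/

section Subcontinua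

variable {J : Set ℝ} {H : Set (ℕ → ℝ)}

theorem proj_subset_Iic (hs : 0 ≤ s) (hH : H ⊆ invLim s J) (n : ℕ) : proj n H ⊆ Iic (s / 2) := by
  rintro _ ⟨x, hx, rfl⟩
  exact le_half_of_mem_invLim hs (hH hx) n

theorem crit_mem_proj_and_boundedByLevel (hs1 : 1 < s) (hne : ∀ n, crit s (n + 1) ≠ 1 / 2)
    (hH : H ⊆ invLim s J) (hconn : IsPreconnected H) {m k : ℕ}
    (hk : (1 / 2 : ℝ) ∈ proj (m + k + 1) H) (hlt : ∀ i < k, (1 / 2 : ℝ) ∉ proj (m + i + 1) H) :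
    crit s (k + 1) ∈ proj m H ∧ BoundedByLevel s k (proj m H) := by
  have hs : 0 ≤ s := by linarith
  have himage := proj_eq_image_tent_proj_succ hH m
  induction k generalizing m with
  | zero =>
    refine ⟨?_, .zero hs1 (proj_subset_Iic hs hH m)⟩
    rw [himage, crit_succ]
    exact mem_image_of_mem _ hk
  | succ k ih =>
    obtain ⟨hcrit, hbound⟩ := ih (m := m + 1) (by rwa [add_right_comm m 1 k])
      (fun i hi => by rw [add_right_comm m 1 i]; exact hlt (i + 1) (by omega))
      (proj_eq_image_tent_proj_succ hH _)
    obtain ⟨b, hb⟩ := exists_mem_lap (crit s (k + 1))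
    have hlap := subset_lap_of_half_notMem (ordConnected_proj hconn (m + 1))
      (hlt 0 k.succ_pos) hcrit hb
    refine ⟨himage ▸ crit_succ s (k + 1) ▸ mem_image_of_mem _ hcrit, ?_⟩
    rw [himage, ← inter_eq_self_of_subset_left hlap]
    exact hbound.image_tent hs hb (hne k)

theorem le_mul_diam_proj (hs1 : 1 < s) {δ : ℝ} (hpos : 0 < δ)
    (hδ : ∀ n, δ ≤ Metric.diam (D s n)) (hH : IsSubcontinuum H (invLim s J)) {m n : ℕ}
    (hmn : m < n) (hm : (1 / 2 : ℝ) ∈ proj m H) (hn : (1 / 2 : ℝ) ∈ proj n H) :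
    δ ≤ s * Metric.diam (proj m H) := by
  have hs : 0 ≤ s := by linarith
  have hex : ∃ k, (1 / 2 : ℝ) ∈ proj (m + k + 1) H :=
    ⟨n - m - 1, by rwa [show m + (n - m - 1) + 1 = n by omega]⟩
  classical
  obtain ⟨hcrit, hbound⟩ := crit_mem_proj_and_boundedByLevel hs1
    (crit_succ_ne_half hδ hs hpos) hH.1 hH.2.2.isPreconnected (Nat.find_spec hex)
    fun i hi => Nat.find_min hex hi
  refine (le_mul_abs_crit_sub_half hδ hs (hbound.half_mem_D hm)).trans
    (mul_le_mul_of_nonneg_left ?_ hs)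
  exact Metric.dist_le_diam_of_mem (isCompact_proj hH.2.1 m).isBounded hcrit hm

theorem core_subset_proj_of_succ (hs1 : 1 < s) (hH : H ⊆ invLim s J) {n : ℕ}
    (h : Icc (1 / 2) (crit s 1) ⊆ proj (n + 1) H) : Icc (crit s 2) (crit s 1) ⊆ proj n H := by
  rw [proj_eq_image_tent_proj_succ hH]
  exact (core_subset_image_tent hs1).trans (image_mono h)

theorem half_notMem_proj_or (hs1 : 1 < s) (hH : H ⊆ invLim s J) (hconn : IsPreconnected H)
    {n : ℕ} (h : ¬Icc (crit s 2) (crit s 1) ⊆ proj n H) :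
    (1 / 2 : ℝ) ∉ proj (n + 1) H ∨ (1 / 2 : ℝ) ∉ proj (n + 2) H := by
  by_contra! hcon
  refine h (core_subset_proj_of_succ hs1 hH ((ordConnected_proj hconn (n + 1)).out hcon.1 ?_))
  rw [proj_eq_image_tent_proj_succ hH, crit_succ]
  exact mem_image_of_mem _ hcon.2

theorem sq_div_two_mul_diam_proj_le (hs1 : 1 < s) (hH : IsSubcontinuum H (invLim s J)) {n : ℕ}
    (h : ¬Icc (crit s 2) (crit s 1) ⊆ proj n H) :
    s ^ 2 / 2 * Metric.diam (proj (n + 2) H) ≤ Metric.diam (proj n H) := by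
  have hs : 0 ≤ s := by linarith
  have fold (m : ℕ) : s / 2 * Metric.diam (proj (m + 1) H) ≤ Metric.diam (proj m H) := by
    rw [proj_eq_image_tent_proj_succ hH.1 m]
    exact half_mul_diam_le_diam_image_tent hs (isCompact_proj hH.2.1 _)
      (ordConnected_proj hH.2.2.isPreconnected _)
  have expand (m : ℕ) (hm : (1 / 2 : ℝ) ∉ proj (m + 1) H) :
      s * Metric.diam (proj (m + 1) H) ≤ Metric.diam (proj m H) := by
    obtain ⟨x, hx⟩ := hH.2.2.nonempty
    obtain ⟨b, hb⟩ := exists_mem_lap (x (m + 1))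
    rw [proj_eq_image_tent_proj_succ hH.1 m]
    exact mul_diam_le_diam_image_tent hs (isCompact_proj hH.2.1 _) (subset_lap_of_half_notMem
      (ordConnected_proj hH.2.2.isPreconnected _) hm (mem_image_of_mem _ hx) hb)
  rcases half_notMem_proj_or hs1 hH.1 hH.2.2.isPreconnected h with h1 | h2
  · calc _ = s * (s / 2 * Metric.diam (proj (n + 2) H)) := by ring
      _ ≤ s * Metric.diam (proj (n + 1) H) := mul_le_mul_of_nonneg_left (fold (n + 1)) hs
      _ ≤ _ := expand n h1
  · calc _ = s / 2 * (s * Metric.diam (proj (n + 2) H)) := by ring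
      _ ≤ s / 2 * Metric.diam (proj (n + 1) H) :=
        mul_le_mul_of_nonneg_left (expand (n + 1) h2) (by positivity)
      _ ≤ _ := fold n

theorem exists_forall_not_core_subset_proj (hs1 : 1 < s)
    (hH : IsSubcontinuum H (coreSpace s)) (hne : H ≠ coreSpace s) :
    ∃ N, ∀ n ≥ N, ¬Icc (crit s 2) (crit s 1) ⊆ proj n H := by
  obtain ⟨N, hN⟩ : ∃ N, ¬Icc (crit s 2) (crit s 1) ⊆ proj N H := by
    by_contra! hcon
    exact hne (hH.1.antisymm fun x hx =>
      mem_of_forall_mem_proj hH.2.1.isClosed hH.1 hx fun n => hcon n (hx.1 n))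
  refine ⟨N, fun n hn => ?_⟩
  induction n, hn using Nat.le_induction with
  | base => exact hN
  | succ n _ ih =>
    exact fun h => ih (core_subset_proj_of_succ hs1 hH.1
      ((Icc_subset_Icc_left (crit_two_lt_half hs1).le).trans h))

theorem eventually_diam_proj_lt (hs1 : 1 < s) (hs2 : s ≤ 2) (hsq : √2 < s)
    (hH : IsSubcontinuum H (coreSpace s)) (hne : H ≠ coreSpace s) {ε : ℝ} (hε : 0 < ε) :
    ∀ᶠ n in atTop, Metric.diam (proj n H) < ε := by
  obtain ⟨N, hN⟩ := exists_forall_not_core_subset_proj hs1 hH hne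
  have hle_one (n : ℕ) : Metric.diam (proj n H) ≤ 1 := by
    have hsub : proj n H ⊆ Icc 0 1 := by
      rintro _ ⟨x, hx, rfl⟩
      exact (coreSpace_subset_space hs1.le hs2 (hH.1 hx)).1 n
    simpa only [Real.diam_Icc zero_le_one, sub_zero] using
      Metric.diam_mono hsub isCompact_Icc.isBounded
  have hpow (M : ℕ) : ∀ n ≥ N, (s ^ 2 / 2) ^ M * Metric.diam (proj (n + 2 * M) H) ≤ 1 := by
    induction M with
    | zero => exact fun n _ => by simpa using hle_one n
    | succ M ih =>
      intro n hn
      refine le_trans ?_ (ih n hn)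
      rw [pow_succ, mul_assoc]
      exact mul_le_mul_of_nonneg_left
        (sq_div_two_mul_diam_proj_le hs1 hH (hN (n + 2 * M) (by omega))) (by positivity)
  have hgrow : 1 < s ^ 2 / 2 := by
    rw [one_lt_div two_pos]
    exact (Real.sqrt_lt' (by linarith)).1 hsq
  obtain ⟨M, hM⟩ := pow_unbounded_of_one_lt (1 / ε) hgrow
  filter_upwards [eventually_ge_atTop (N + 2 * M)] with n hn
  have hn' := hpow M (n - 2 * M) (by omega)
  rw [Nat.sub_add_cancel (by omega : 2 * M ≤ n)] at hn'
  rw [div_lt_iff₀ hε] at hM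
  exact lt_of_mul_lt_mul_left (hn'.trans_lt hM) (by positivity)

theorem eventually_half_notMem_proj (hs1 : 1 < s) (hs2 : s ≤ 2) (hsq : √2 < s)
    (hlong : LongBranched s) (hH : IsSubcontinuum H (coreSpace s)) (hne : H ≠ coreSpace s) :
    ∀ᶠ n in atTop, (1 / 2 : ℝ) ∉ proj n H := by
  obtain ⟨δ, hpos, hδ⟩ := hlong
  have hs : 0 < s := by linarith
  by_contra hfreq
  simp only [not_eventually, not_not] at hfreq
  obtain ⟨m, hm, hdiam⟩ := (hfreq.and_eventually
    (eventually_diam_proj_lt hs1 hs2 hsq hH hne (div_pos hpos hs))).exists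
  obtain ⟨n, hmn, hn⟩ := frequently_atTop'.1 hfreq m
  rw [lt_div_iff₀' hs] at hdiam
  exact (le_mul_diam_proj hs1 hpos hδ hH hmn hm hn).not_gt hdiam

theorem injOn_apply_of_half_notMem_proj (hs : 0 < s) (hH : H ⊆ invLim s J)
    (hconn : IsPreconnected H) {N : ℕ} (hN : ∀ n > N, (1 / 2 : ℝ) ∉ proj n H) :
    InjOn (fun x : ℕ → ℝ => x N) H := by
  intro x hx y hy (hxy : x N = y N)
  have hup : ∀ n ≥ N, x n = y n := by
    intro n hn
    induction n, hn using Nat.le_induction with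
    | base => exact hxy
    | succ n hn ih =>
      obtain ⟨b, hb⟩ := exists_mem_lap (x (n + 1))
      have hlap := subset_lap_of_half_notMem (ordConnected_proj hconn (n + 1))
        (hN (n + 1) (by omega)) (mem_image_of_mem _ hx) hb
      refine injOn_tent_lap hs b hb (hlap (mem_image_of_mem _ hy)) ?_
      rw [(hH hx).2, (hH hy).2, ih]
  ext i
  exact eq_of_le_of_eq (hH hx) (hH hy) (hup _ (le_max_right i N)) (le_max_left i N)

end Subcontinua

theorem isArc_of_injOn {E : Type*} [TopologicalSpace E] {H : Set E} (hcomp : IsCompact H)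
    (hconn : IsConnected H) (hnt : H.Nontrivial) {f : E → ℝ} (hf : Continuous f)
    (hinj : InjOn f H) : IsArc H := by
  have hP : f '' H = Icc (sInf (f '' H)) (sSup (f '' H)) :=
    eq_Icc_of_connected_compact (hconn.image _ hf.continuousOn) (hcomp.image hf)
  obtain ⟨x, hx, y, hy, hxy⟩ := hnt.image_of_injOn hinj
  have hlt : sInf (f '' H) < sSup (f '' H) := not_le.1 fun h =>
    hxy (subsingleton_Icc_of_ge h (hP.subset hx) (hP.subset hy))
  have : CompactSpace H := isCompact_iff_compactSpace.1 hcomp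
  let g : H ≃ₜ f '' H := Continuous.homeoOfEquivCompactToT2 (f := Equiv.Set.imageOfInjOn f H hinj)
    ((hf.comp continuous_subtype_val).subtype_mk _)
  exact ⟨((g.trans (Homeomorph.setCongr hP)).trans (iccHomeoI _ _ hlt)).symm⟩

theorem isArc_of_ne_coreSpace (hs1 : 1 < s) (hs2 : s ≤ 2) (hsq : √2 < s)
    (hlong : LongBranched s) {H : Set (ℕ → ℝ)} (hH : IsSubcontinuum H (coreSpace s))
    (hne : H ≠ coreSpace s) (hnt : H.Nontrivial) : IsArc H := by
  obtain ⟨N, hN⟩ := eventually_atTop.1 (eventually_half_notMem_proj hs1 hs2 hsq hlong hH hne)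
  exact isArc_of_injOn hH.2.1 hH.2.2 hnt (continuous_apply N)
    (injOn_apply_of_half_notMem_proj (by linarith) hH.1 hH.2.2.isPreconnected
      fun n hn => hN n hn.le)

/-! ### Basic arcs -/

/-- `p` is an end of an interval `U` of the kind that occurs in the images of cylinders: either the
fixed point `0` or a point `c_{a+1}` for which the level `D_{a+1}` of the tower bounds `U`. -/
def IsTowerEnd (s p : ℝ) (U : Set ℝ) : Prop :=
  p = 0 ∨ ∃ a, p = crit s (a + 1) ∧ BoundedByLevel s a U

/-- `U` is an interval of length at least `δ` both of whose ends are tower ends. -/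
def IsTowerInterval (s δ : ℝ) (U : Set ℝ) : Prop :=
  ∃ p q, U = uIcc p q ∧ δ ≤ |p - q| ∧ IsTowerEnd s p U ∧ IsTowerEnd s q U

section TowerInterval

variable {δ p : ℝ} {U : Set ℝ}

namespace IsTowerEnd

theorem crit_one (hs1 : 1 < s) (hU : U ⊆ Iic (s / 2)) : IsTowerEnd s (crit s 1) U :=
  Or.inr ⟨0, rfl, .zero hs1 hU⟩

theorem image_tent (h : IsTowerEnd s p U) (hs : 0 ≤ s) (hp : p ∈ lap b) (hne : p ≠ 1 / 2) :
    IsTowerEnd s (tent s p) (tent s '' (U ∩ lap b)) := by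
  rcases h with rfl | ⟨a, rfl, ha⟩
  · exact Or.inl (by rw [tent_of_le_half hs (by norm_num), mul_zero])
  · exact Or.inr ⟨a + 1, (crit_succ s (a + 1)).symm, ha.image_tent hs hp hne⟩

theorem ne_half (h : IsTowerEnd s p U) (hδ : ∀ n, δ ≤ Metric.diam (D s n)) (hs : 0 ≤ s)
    (hpos : 0 < δ) : p ≠ 1 / 2 := by
  rcases h with rfl | ⟨a, rfl, -⟩
  · norm_num
  · exact crit_succ_ne_half hδ hs hpos a

theorem le_mul_abs_sub_half (h : IsTowerEnd s p U) (hδ : ∀ n, δ ≤ Metric.diam (D s n))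
    (hs1 : 1 < s) (hU : (1 / 2 : ℝ) ∈ U) : δ ≤ s * |p - 1 / 2| := by
  rcases h with rfl | ⟨a, rfl, ha⟩
  · calc δ ≤ Metric.diam (D s 0) := hδ 0
      _ = s / 2 - 1 / 2 := by
        rw [D_zero hs1, Real.diam_Icc (half_lt_crit_one hs1).le, TentInvLim.crit_one (by linarith)]
      _ ≤ s * |0 - 1 / 2| := by
        rw [zero_sub, abs_neg, abs_of_pos one_half_pos]
        linarith
  · exact le_mul_abs_crit_sub_half hδ (by linarith) (ha.half_mem_D hU)

end IsTowerEnd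

theorem isTowerInterval_Icc (hδ : ∀ n, δ ≤ Metric.diam (D s n)) (hs1 : 1 < s) :
    IsTowerInterval s δ (Icc 0 (s / 2)) := by
  have hdiam := hδ 0
  rw [D_zero hs1, Real.diam_Icc (half_lt_crit_one hs1).le, crit_one (by linarith)] at hdiam
  refine ⟨0, crit s 1, ?_, ?_, Or.inl rfl, .crit_one hs1 Icc_subset_Iic_self⟩
  · rw [crit_one (by linarith), uIcc_of_le (by linarith)]
  · rw [crit_one (by linarith), zero_sub, abs_neg, abs_of_pos (by linarith)]
    linarith

theorem IsTowerInterval.image_tent (h : IsTowerInterval s δ U)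
    (hδ : ∀ n, δ ≤ Metric.diam (D s n)) (hs1 : 1 < s) (hpos : 0 < δ)
    (hne : (U ∩ lap b).Nonempty) : IsTowerInterval s δ (tent s '' (U ∩ lap b)) := by
  have hs : 0 ≤ s := by linarith
  obtain ⟨p, q, hU, hlen, hp, hq⟩ := h
  wlog hpb : p ∈ lap b generalizing p q
  · refine this q p (by rw [hU, uIcc_comm]) (by rwa [abs_sub_comm]) hq hp ?_
    by_contra hqb
    obtain ⟨x, hxU, hx⟩ := hne
    exact (ordConnected_compl_lap b).uIcc_subset hpb hqb (hU ▸ hxU) hx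
  have hp_ne := hp.ne_half hδ hs hpos
  have hq_ne := hq.ne_half hδ hs hpos
  by_cases hqb : q ∈ lap b
  · refine ⟨tent s p, tent s q, ?_, ?_, hp.image_tent hs hpb hp_ne, hq.image_tent hs hqb hq_ne⟩
    · rw [← image_tent_uIcc hs hpb hqb, hU,
        inter_eq_self_of_subset_left ((ordConnected_lap b).uIcc_subset hpb hqb)]
    · rw [abs_tent_sub_tent hs hpb hqb]
      exact hlen.trans (le_mul_of_one_le_left (abs_nonneg _) hs1.le)
  · have hhalf : (1 / 2 : ℝ) ∈ uIcc p q := by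
      by_contra hnot
      exact hqb (subset_lap_of_half_notMem ordConnected_uIcc hnot left_mem_uIcc hpb right_mem_uIcc)
    refine ⟨tent s p, crit s 1, ?_, ?_, hp.image_tent hs hpb hp_ne, .crit_one hs1 ?_⟩
    · rw [hU, uIcc_inter_lap hpb hp_ne hhalf, image_tent_uIcc hs hpb (half_mem_lap b), crit_succ,
        crit_zero]
    · rw [crit_succ, crit_zero, abs_tent_sub_tent_half hs]
      exact hp.le_mul_abs_sub_half hδ hs1 (hU ▸ hhalf)
    · exact image_subset_iff.2 fun y _ => tent_le hs y

end TowerInterval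

/-- The image under `T^n` of the cylinder of the points of `[0, c_1]` whose first `n` symbols are
`e (n - 1), …, e 0`. -/
def branchImage (s : ℝ) : ℕ → (ℕ → Bool) → Set ℝ
  | 0, _ => Icc 0 (s / 2)
  | n + 1, e => tent s '' (branchImage s n (fun i => e (i + 1)) ∩ lap (e 0))

/-- The coordinates at `0` of the points of `X` with left itinerary `e`. -/
def itineraryParams (s : ℝ) (e : ℕ → Bool) : Set ℝ :=
  ⋂ n, branchImage s n e

section BasicArc

variable {e : ℕ → Bool} {x : ℕ → ℝ} {t : ℝ} {n : ℕ}

theorem ordConnected_branchImage (s : ℝ) (n : ℕ) (e : ℕ → Bool) :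
    OrdConnected (branchImage s n e) := by
  induction n generalizing e with
  | zero => exact ordConnected_Icc
  | succ n ih => exact ordConnected_image_tent ((ih _).inter (ordConnected_lap _))

theorem isCompact_branchImage (s : ℝ) (n : ℕ) (e : ℕ → Bool) : IsCompact (branchImage s n e) := by
  induction n generalizing e with
  | zero => exact isCompact_Icc
  | succ n ih => exact ((ih _).inter_right (isClosed_lap _)).image (continuous_tent s)

theorem antitone_branchImage (hs : 0 ≤ s) (hs2 : s ≤ 2) (e : ℕ → Bool) :
    Antitone fun n => branchImage s n e := by
  refine antitone_nat_of_succ_le fun n => ?_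
  induction n generalizing e with
  | zero =>
    rintro _ ⟨u, ⟨hu, -⟩, rfl⟩
    exact ⟨(mapsTo_tent_Icc hs hs2 ⟨hu.1, hu.2.trans (by linarith)⟩).1, tent_le hs u⟩
  | succ n ih => exact image_mono (inter_subset_inter_left _ (ih _))

theorem apply_zero_mem_branchImage (hs : 0 ≤ s) (hx : x ∈ space s) (he : IsLeftItinerary x e)
    (n : ℕ) : x 0 ∈ branchImage s n e := by
  induction n generalizing x e with
  | zero => exact ⟨(hx.1 0).1, le_half_of_mem_invLim hs hx 0⟩
  | succ n ih =>
    exact ⟨x 1, ⟨ih (tail_mem_invLim hx 1) fun i => he (i + 1), isLeftItinerary_iff.1 he 0⟩, hx.2 0⟩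

theorem branch_nonneg_of_mem_branchImage (hs : 0 < s) (h : t ∈ branchImage s n e) :
    0 ≤ branch s e t n := by
  induction n generalizing t e with
  | zero => exact h.1
  | succ n ih =>
    obtain ⟨u, ⟨hu, hlap⟩, rfl⟩ := h
    exact (branch_tent hs hlap n).symm ▸ ih hu

theorem branch_mem_lap_of_mem_branchImage (hs : 0 < s) (h : t ∈ branchImage s (n + 1) e) :
    branch s e t (n + 1) ∈ lap (e n) := by
  induction n generalizing t e with
  | zero =>
    obtain ⟨u, ⟨-, hlap⟩, rfl⟩ := h
    exact (branch_tent hs hlap 0).symm ▸ hlap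
  | succ n ih =>
    obtain ⟨u, ⟨hu, hlap⟩, rfl⟩ := h
    exact (branch_tent hs hlap (n + 1)).symm ▸ ih hu

theorem apply_zero_mem_itineraryParams (hs : 0 ≤ s) (hx : x ∈ space s)
    (he : IsLeftItinerary x e) : x 0 ∈ itineraryParams s e :=
  mem_iInter.2 (apply_zero_mem_branchImage hs hx he)

theorem branch_mem_space_and_isLeftItinerary (hs : 0 < s) (hs2 : s ≤ 2)
    (ht : t ∈ itineraryParams s e) :
    branch s e t ∈ space s ∧ IsLeftItinerary (branch s e t) e := by
  rw [itineraryParams, mem_iInter] at ht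
  have hlap := isLeftItinerary_iff.2 fun n => branch_mem_lap_of_mem_branchImage hs (ht (n + 1))
  exact ⟨branch_mem_space hs hs2 (fun n => branch_nonneg_of_mem_branchImage hs (ht n)) hlap, hlap⟩

theorem isCompact_itineraryParams (s : ℝ) (e : ℕ → Bool) : IsCompact (itineraryParams s e) :=
  (isCompact_branchImage s 0 e).of_isClosed_subset
    (isClosed_iInter fun n => (isCompact_branchImage s n e).isClosed) (iInter_subset _ 0)

theorem isPreconnected_itineraryParams (s : ℝ) (e : ℕ → Bool) :
    IsPreconnected (itineraryParams s e) :=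
  (ordConnected_iInter fun n => ordConnected_branchImage s n e).isPreconnected

theorem basicArc_eq_image (hs : 0 < s) (hs2 : s ≤ 2) (e : ℕ → Bool) :
    basicArc s e = branch s e '' itineraryParams s e := by
  have himage : {x | x ∈ space s ∧ IsLeftItinerary x e} = branch s e '' itineraryParams s e := by
    ext x
    constructor
    · rintro ⟨hx, he⟩
      exact ⟨x 0, apply_zero_mem_itineraryParams hs.le hx he, branch_apply_zero hs hx he⟩
    · rintro ⟨t, ht, rfl⟩
      exact branch_mem_space_and_isLeftItinerary hs hs2 ht
  rw [basicArc, himage]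
  exact ((isCompact_itineraryParams s e).image (continuous_branch s e)).isClosed.closure_eq

theorem isTowerInterval_branchImage {δ : ℝ} (hδ : ∀ n, δ ≤ Metric.diam (D s n)) (hs1 : 1 < s)
    (hpos : 0 < δ) (hx : x ∈ space s) (he : IsLeftItinerary x e) (n : ℕ) :
    IsTowerInterval s δ (branchImage s n e) := by
  induction n generalizing x e with
  | zero => exact isTowerInterval_Icc hδ hs1
  | succ n ih =>
    have hx' := tail_mem_invLim hx 1
    have he' : IsLeftItinerary (fun i => x (i + 1)) fun i => e (i + 1) := fun i => he (i + 1)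
    exact (ih hx' he').image_tent hδ hs1 hpos
      ⟨x 1, apply_zero_mem_branchImage (by linarith) hx' he' n, isLeftItinerary_iff.1 he 0⟩

end BasicArc

theorem exists_ne_forall_mem_of_antitone {U : ℕ → Set ℝ} (hU : Antitone U) {δ x : ℝ}
    (hδ : 0 < δ) (hlen : ∀ n, ∃ p q, U n = uIcc p q ∧ δ ≤ |p - q|) (hx : ∀ n, x ∈ U n) :
    ∃ t ≠ x, ∀ n, t ∈ U n := by
  have hor (n : ℕ) : x + δ / 2 ∈ U n ∨ x - δ / 2 ∈ U n := by
    obtain ⟨p, q, hpq, hlen⟩ := hlen n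
    have hxn := hx n
    rw [hpq, uIcc] at hxn ⊢
    rw [← max_sub_min_eq_abs'] at hlen
    by_contra! hcon
    have hhi : max p q < x + δ / 2 := by
      by_contra! h
      exact hcon.1 ⟨hxn.1.trans (by linarith), h⟩
    have hlo : x - δ / 2 < min p q := by
      by_contra! h
      exact hcon.2 ⟨h, le_trans (by linarith) hxn.2⟩
    linarith
  by_cases hall : ∀ n, x + δ / 2 ∈ U n
  · exact ⟨_, by linarith, hall⟩
  · obtain ⟨N, hN⟩ := not_forall.1 hall
    refine ⟨x - δ / 2, by linarith, fun n => hU (le_max_left n N) ?_⟩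
    exact (hor (max n N)).resolve_left fun h => hN (hU (le_max_right n N) h)

theorem exists_itineraryParams_eq_Icc (hs1 : 1 < s) (hs2 : s ≤ 2) (hlong : LongBranched s)
    {e : ℕ → Bool} {x : ℕ → ℝ} (hx : x ∈ space s) (he : IsLeftItinerary x e) :
    ∃ p q, p < q ∧ itineraryParams s e = Icc p q := by
  have hs : 0 ≤ s := by linarith
  obtain ⟨δ, hpos, hδ⟩ := hlong
  have hx0 := apply_zero_mem_itineraryParams hs hx he
  obtain ⟨t, htx, ht⟩ := exists_ne_forall_mem_of_antitone (antitone_branchImage hs hs2 e) hpos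
    (fun n =>
      let ⟨p, q, hU, hlen, _⟩ := isTowerInterval_branchImage hδ hs1 hpos hx he n
      ⟨p, q, hU, hlen⟩)
    (apply_zero_mem_branchImage hs hx he)
  have hIcc := eq_Icc_of_connected_compact ⟨⟨_, hx0⟩, isPreconnected_itineraryParams s e⟩
    (isCompact_itineraryParams s e)
  exact ⟨_, _, not_le.1 fun h => htx (subsingleton_Icc_of_ge h
    (hIcc.subset (mem_iInter.2 ht)) (hIcc.subset hx0)), hIcc⟩

theorem isArcEnd_image_uIcc {E : Type*} [TopologicalSpace E] [T2Space E] {f : ℝ → E}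
    (hf : Continuous f) (hinj : Function.Injective f) {p q : ℝ} (hpq : p ≠ q) :
    IsArcEnd (f '' uIcc p q) (f p) := by
  let g : ℝ → E := fun u => f (p + u * (q - p))
  have himage : g '' Icc 0 1 = f '' uIcc p q := by
    rw [← segment_eq_uIcc, segment_eq_image', image_image]
    rfl
  have hg_inj : InjOn g (Icc 0 1) := fun u _ v _ huv =>
    mul_right_cancel₀ (sub_ne_zero.2 hpq.symm) (add_left_cancel (hinj huv))
  have hg : Continuous g := hf.comp (by fun_prop)
  let h : unitInterval ≃ₜ g '' Icc 0 1 := Continuous.homeoOfEquivCompactToT2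
    (f := Equiv.Set.imageOfInjOn g (Icc 0 1) hg_inj)
    ((hg.comp continuous_subtype_val).subtype_mk _)
  refine ⟨h.trans (Homeomorph.setCongr himage), ?_⟩
  change f (p + 0 * (q - p)) = f p
  rw [zero_mul, add_zero]

theorem endpoints_subset_flatEndpoints (hs1 : 1 < s) (hs2 : s ≤ 2) (hlong : LongBranched s) :
    endpoints (space s) ⊆ flatEndpoints s := by
  intro x hx
  have hs : 0 < s := by linarith
  obtain ⟨e, he⟩ := exists_isLeftItinerary x
  have hbranch := branch_apply_zero hs hx.1 he
  obtain ⟨p, q, hlt, hpq⟩ := exists_itineraryParams_eq_Icc hs1 hs2 hlong hx.1 he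
  have hx0 := hpq ▸ apply_zero_mem_itineraryParams hs.le hx.1 he
  refine ⟨hx, e, he, ?_⟩
  rw [basicArc_eq_image hs hs2, hpq, ← hbranch]
  have harcEnd {p q : ℝ} (h : p ≠ q) : IsArcEnd (branch s e '' uIcc p q) (branch s e p) :=
    isArcEnd_image_uIcc (continuous_branch s e) (injective_branch s e) h
  rcases hx0.1.eq_or_lt with hp | hp
  · rw [← uIcc_of_le hlt.le, ← hp]
    exact harcEnd hlt.ne
  rcases hx0.2.eq_or_lt with hq | hq
  · rw [← uIcc_of_ge hlt.le, hq]
    exact harcEnd hlt.ne'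
  · exact absurd (hbranch.symm ▸ hx) (branch_notMem_endpoints hp hq fun u hu =>
      (branch_mem_space_and_isLeftItinerary hs hs2 (hpq ▸ hu)).1)

end TentInvLim

theorem proposition4p7_general (s : ℝ) (hs1 : 1 < s) (hs2 : s ≤ 2) :
    (√2 < s → TentInvLim.LongBranched s → ∀ H : Set (ℕ → ℝ),
      TentInvLim.IsSubcontinuum H (TentInvLim.coreSpace s) → H ≠ TentInvLim.coreSpace s →
      H.Nontrivial → TentInvLim.IsArc H) ∧
    (s < 2 → ((TentInvLim.endpoints (TentInvLim.space s) ∩ TentInvLim.coreSpace s).Nonempty ↔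
      TentInvLim.CritRecurrent s)) ∧
    (TentInvLim.LongBranched s →
      TentInvLim.endpoints (TentInvLim.space s) = TentInvLim.flatEndpoints s) :=
  ⟨fun hsq hlong _ hH hne hnt => TentInvLim.isArc_of_ne_coreSpace hs1 hs2 hsq hlong hH hne hnt,
    fun hs_lt => ⟨TentInvLim.critRecurrent_of_exists_endpoint hs1 hs_lt,
      TentInvLim.CritRecurrent.exists_endpoint hs1 hs2⟩,
    fun hlong => (TentInvLim.endpoints_subset_flatEndpoints hs1 hs2 hlong).antisymm
      fun _ hx => hx.1⟩

theorem proposition4p7 (s : ℝ) (hs1 : 1 < s) (hs2 : s ≤ 2)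
    (hinf : (Set.range (TentInvLim.crit s)).Infinite)
    (hlong : TentInvLim.LongBranched s) :
    (√2 < s → ∀ H : Set (ℕ → ℝ),
      TentInvLim.IsSubcontinuum H (TentInvLim.coreSpace s) → H ≠ TentInvLim.coreSpace s →
      H.Nontrivial → TentInvLim.IsArc H) ∧
    ((TentInvLim.endpoints (TentInvLim.space s) ∩ TentInvLim.coreSpace s).Nonempty ↔
      TentInvLim.CritRecurrent s) ∧
    (TentInvLim.CritRecurrent s →
      TentInvLim.endpoints (TentInvLim.space s) = TentInvLim.flatEndpoints s) := by
  obtain ⟨harc, hrec, hflat⟩ := proposition4p7_general s hs1 hs2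
  exact ⟨fun hsq => harc hsq hlong, hrec (TentInvLim.lt_two_of_infinite_range_crit hs2 hinf),
    fun _ => hflat hlong⟩
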